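/- **Networks.** A ReLU network with $L\ge 1$ layers is given by matrices $W_k\in\mathbb R^{\ell_k\times\ell_{k-1}}$ and vectors $b_k\in\mathbb R^{\ell_k}$, $k=1,\dots,L$, with all $\ell_k\geq 1$. With $A_k(x)=W_kx+b_k$ and $\varrho(x)=\max\{x,0\}$ acting componentwise, it realizes the map $\Phi=A_L\circ\varrho\circ A_{L-1}\circ\cdots\circ\varrho\circ A_1:\mathbb R^{\ell_0}\to\mathbb R^{\ell_L}$. Its depth is $L$, its width is $\max\{\ell_1,\dots,\ell_L\}$, and $\mathcal B(\Phi)$ is the largest absolute value of an entry of the $W_k$ and $b_k$. **Function class.** For a monotonically increasing sequence $\boldsymbol\lambda=(\lambda_j)_{j\ge0}$ of positive numbers, $D>0$ and $\mathbb K\in\{\mathbb R,\mathbb C\}$, let $\mathcal P_{\boldsymbol\lambda,D,\mathbb K}$ be the set of $f\in C^\infty([-D,D],\mathbb K)$ with $\|f^{(j)}\|_{L^\infty((-D,D))}\le\lambda_j$ for all $j\ge0$. **Proposition A.2.** There are an absolute constant $C>0$ and constants $\widetilde C_n>0$ depending only on $n$ such that the following holds for every monotonically increasing sequence $\boldsymbol\lambda$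 of positive numbers, every $D>0$ and every integer $n\ge2$. There is a constant $B_n$ with $$0<B_n\le C\max\Big\{n+2,\;4\big(\widetilde C_n D^{n+1}\lambda_{n+1}\big)^{\frac1{n-1}}\Big\}$$ such that for every $\epsilon\in(0,1)$ with $\epsilon\le D\lambda_n$ (hence for all sufficiently small $\epsilon>0$): (i) for every $f\in\mathcal P_{\boldsymbol\lambda,D,\mathbb R}$ there is a ReLU network $\Phi$ with one input and one output, of width at most $13$ and of depth $$L\le B_n\Big(B_n\epsilon^{-\frac2{n-1}}+\epsilon^{-\frac1{n-1}}\log\big(\tfrac2\epsilon\big)+\epsilon^{-\frac1{n-1}}\log D+\epsilon^{-\frac1{n-1}}\log\lambda_n\Big),$$ such that $\|f-\Phi\|_{L^\infty((-D,D))}\le\epsilon$ and $\mathcal B(\Phi)\le\max\{2,\lambda_n\}$; (ii) for every $f\in\mathcal P_{\boldsymbol\lambda,D,\mathbb C}$ there is a ReLU network $\Phi$ with one input and two outputs, of width at most $15$ and of depth $L$ bounded as in (i), such that $\|f-(\Phi_1+\mathrm i\,\Phi_2)\|_{L^\infty((-D,D))}\le\epsilon$ and $\mathcal B(\Phi)\le\max\{2,\lambda_n\}$.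 -/

import Mathlib

open scoped NNReal ContDiff

/-- A feedforward, fully connected neural network architecture with its weights, with input
dimension `m` and output dimension `p`: a list of affine maps `x ↦ W x + b`, one per layer, all
layers having positive dimension.  `last W b` is a network with the single layer `(W, b)`, and
`cons W b Φ` is the network whose first layer is `(W, b)` and whose other layers are those
of `Φ`. -/
inductive DNN : ℕ → ℕ → Type
  | last {m p : ℕ} (hp : 0 < p) (W : Matrix (Fin p) (Fin m) ℝ) (b : Fin p → ℝ) : DNN m p
  | cons {m k p : ℕ} (hk : 0 < k) (W : Matrix (Fin k) (Fin m) ℝ) (b : Fin k → ℝ)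
      (Φ : DNN k p) : DNN m p

namespace DNN

/-- The map `A_L ∘ ϱ ∘ A_{L-1} ∘ ϱ ∘ ⋯ ∘ ϱ ∘ A_1` realized by a network with activation function
`ϱ`, which acts componentwise (there is no activation after the last layer). -/
def eval (ϱ : ℝ → ℝ) : {m p : ℕ} → DNN m p → (Fin m → ℝ) → (Fin p → ℝ)
  | _, _, last _ W b, x => W.mulVec x + b
  | _, _, cons _ W b Φ, x => eval ϱ Φ (fun i => ϱ ((W.mulVec x + b) i))

/-- The depth: the number `L` of layers, that is, of affine maps. -/
def depth : {m p : ℕ} → DNN m p → ℕ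
  | _, _, last _ _ _ => 1
  | _, _, cons _ _ _ Φ => depth Φ + 1

/-- The width `max {ℓ_1, …, ℓ_L}`: the largest dimension of a layer, the input layer excluded and
the output layer included. -/
def width : {m p : ℕ} → DNN m p → ℕ
  | _, p, last _ _ _ => p
  | _, _, cons (k := k) _ _ _ Φ => max k (width Φ)

/-- The largest absolute value of an entry of the weight matrix `W` or of the bias vector `b`. -/
noncomputable def layerBound {m k : ℕ} (W : Matrix (Fin k) (Fin m) ℝ) (b : Fin k → ℝ) : ℝ≥0 :=
  max (Finset.univ.sup fun ij : Fin k × Fin m => ‖W ij.1 ij.2‖₊)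
    (Finset.univ.sup fun i : Fin k => ‖b i‖₊)

/-- The largest absolute value of a weight (matrix entry or bias) of the network. -/
noncomputable def weightBound : {m p : ℕ} → DNN m p → ℝ≥0
  | _, _, last _ W b => layerBound W b
  | _, _, cons _ W b Φ => max (layerBound W b) (weightBound Φ)

end DNN

/-- The ReLU activation function. -/
noncomputable def relu (x : ℝ) : ℝ := max x 0

/-- The functions in `C^∞([-D, D], E)` (with `E = ℝ` or `E = ℂ`) whose `j`-th derivative is
bounded by `lam j` on `(-D, D)`, for every `j ≥ 0`. -/
def smoothClass (lam : ℕ → ℝ) (D : ℝ) (E : Type*) [NormedAddCommGroup E] [NormedSpace ℝ E] :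
    Set (ℝ → E) :=
  {f | ContDiffOn ℝ ∞ f (Set.Icc (-D) D) ∧
    ∀ j : ℕ, ∀ x ∈ Set.Ioo (-D) D, ‖iteratedDerivWithin j f (Set.Icc (-D) D) x‖ ≤ lam j}

/-- The depth bound
`B (B ε^{-2/(n-1)} + ε^{-1/(n-1)} log (2/ε) + ε^{-1/(n-1)} log D + ε^{-1/(n-1)} log lam_n)`,
as a function of `B`, `n`, `D`, `lam_n` and `ε`. -/
noncomputable def depthBound (B : ℝ) (n : ℕ) (D lam_n ε : ℝ) : ℝ :=
  B * (B * ε ^ (-(2 / ((n : ℝ) - 1))) + ε ^ (-(1 / ((n : ℝ) - 1))) * Real.log (2 / ε)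
    + ε ^ (-(1 / ((n : ℝ) - 1))) * Real.log D + ε ^ (-(1 / ((n : ℝ) - 1))) * Real.log lam_n)

/-! ### Networks as register machines -/

/-! The network runs a program on 13 nonnegative registers. ReLU fixes nonnegative numbers, so one
layer can overwrite one register and keep the others (`Precomp.assign`); programs then compose with
additive depth, constant width and weights at most 2.

Products come from `y * p = (|y + p| / 2) ^ 2 - (|y - p| / 2) ^ 2` together with the tent-map
expansion of `z - z ^ 2`, with error `4 ^ (-(k + 1))` after `k` iterations. A Horner scheme built on
them evaluates Taylor polynomials on `[0, h]`, where `h ≤ 1 / 4`.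

No partition of unity is needed. The half-interval `[0, D]` is cut into `M` pieces of length `h = D
/ M`, each piece contributes the approximate increment of `g` over its part of `[0, u]`, and these
telescope to `g u - g 0` (`sum_increments`). The negative side is handled by reflection. Piece
positions never enter as weights: the program peels off `h` repeatedly. Coefficients are divided by
`2 * lam n`, and only the output layer multiplies by `lam n`, whence the weight bound.

It remains to choose `M` and `k` (`exists_parameters`) and to compare the depth, of order `n * M *
k`, with the allowed bound, which factors as `B * E * (B * E + G)` (`le_depthBound`). If `lam n` or
`D ^ 2 * lam n` is at most `ε / 2`, a single affine layer suffices. -/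

lemma relu_nonneg (x : ℝ) : 0 ≤ relu x := le_max_right _ _

lemma relu_of_nonneg {x : ℝ} (hx : 0 ≤ x) : relu x = x := max_eq_left hx

lemma relu_sub_relu_neg (x : ℝ) : relu x - relu (-x) = x := by
  unfold relu
  rcases le_total x 0 with h | h
  · rw [max_eq_right h, max_eq_left (by linarith)]; ring
  · rw [max_eq_left h, max_eq_right (by linarith)]; ring

lemma relu_add_relu_neg (x : ℝ) : relu x + relu (-x) = |x| := by
  unfold relu
  rcases le_total x 0 with h | h
  · rw [max_eq_right h, max_eq_left (by linarith), abs_of_nonpos h]; ring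
  · rw [max_eq_left h, max_eq_right (by linarith), abs_of_nonneg h]; ring

namespace DNN

lemma layerBound_le {m k : ℕ} {W : Matrix (Fin k) (Fin m) ℝ} {b : Fin k → ℝ} {c : ℝ≥0}
    (hW : ∀ i j, |W i j| ≤ c) (hb : ∀ i, |b i| ≤ c) : layerBound W b ≤ c := by
  refine max_le (Finset.sup_le fun ij _ => ?_) (Finset.sup_le fun i _ => ?_)
  · exact_mod_cast hW ij.1 ij.2
  · exact_mod_cast hb i

/-- The map `F` on nonnegative vectors is computed by `L` ReLU layers of width `d` with weights
bounded by `2`, which can be put in front of any network. -/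
def Precomp (d L : ℕ) (F : (Fin d → ℝ) → (Fin d → ℝ)) : Prop :=
  (∀ s, 0 ≤ s → 0 ≤ F s) ∧ ∀ {p : ℕ} (Φ : DNN d p), ∃ Ψ : DNN d p,
    Ψ.depth = Φ.depth + L ∧ Ψ.width ≤ max d Φ.width ∧ Ψ.weightBound ≤ max 2 Φ.weightBound ∧
    ∀ s, 0 ≤ s → Ψ.eval relu s = Φ.eval relu (F s)

lemma Precomp.id {d : ℕ} : Precomp d 0 (fun s => s) :=
  ⟨fun _ h => h, fun Φ => ⟨Φ, rfl, le_max_right _ _, le_max_right _ _, fun _ _ => rfl⟩⟩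

lemma Precomp.comp {d L L' : ℕ} {F F' : (Fin d → ℝ) → (Fin d → ℝ)} (h : Precomp d L F)
    (h' : Precomp d L' F') : Precomp d (L + L') (fun s => F' (F s)) := by
  refine ⟨fun s hs => h'.1 _ (h.1 s hs), fun Φ => ?_⟩
  obtain ⟨Ψ', d', w', b', e'⟩ := h'.2 Φ
  obtain ⟨Ψ, d₁, w, b, e⟩ := h.2 Ψ'
  refine ⟨Ψ, by omega, w.trans (by omega), b.trans ?_, fun s hs => ?_⟩
  · exact max_le (le_max_left _ _) b'
  · rw [e s hs, e' _ (h.1 s hs)]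

/-- The instruction `s i := ϱ (α s j + β s k + γ s l + b)`, which leaves the other registers
unchanged. -/
noncomputable def assign {d : ℕ} (i j k l : Fin d) (α β γ b : ℝ) (s : Fin d → ℝ) : Fin d → ℝ :=
  Function.update s i (relu (α * s j + β * s k + γ * s l + b))

/-- All rows except row `i` are identity rows, on which ReLU does nothing. Distinctness of `j`, `k`,
`l` keeps the coefficients from adding up, so entries stay at most 2; unneeded operands get
coefficient 0. -/
lemma Precomp.assign {d : ℕ} (i j k l : Fin d) {α β γ b : ℝ}
    (hjk : j ≠ k := by decide) (hjl : j ≠ l := by decide) (hkl : k ≠ l := by decide)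
    (hα : |α| ≤ 2 := by norm_num) (hβ : |β| ≤ 2 := by norm_num)
    (hγ : |γ| ≤ 2 := by norm_num) (hb : |b| ≤ 2 := by norm_num) :
    Precomp d 1 (assign i j k l α β γ b) := by
  constructor
  · intro s hs r
    unfold DNN.assign
    by_cases h : r = i
    · subst h; simpa using relu_nonneg _
    · simpa [h] using hs r
  intro p Φ
  let a : Fin d → ℝ := Pi.single j α + Pi.single k β + Pi.single l γ
  have ha : ∀ r, |a r| ≤ 2 := by
    intro r
    simp only [a, Pi.add_apply, Pi.single_apply]
    split_ifs <;> simp_all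
  refine ⟨cons i.pos (Matrix.updateRow 1 i a) (Function.update 0 i b) Φ, rfl, le_rfl, ?_, ?_⟩
  · refine max_le_max (layerBound_le (fun r c => ?_) fun r => ?_) le_rfl
    · by_cases h : r = i
      · subst h; simpa using ha c
      · rw [Matrix.updateRow_ne h, Matrix.one_apply]
        split_ifs <;> norm_num
    · by_cases h : r = i
      · subst h; simpa using hb
      · simp [h]
  · intro s hs
    simp only [eval]
    congr 1
    ext r
    unfold DNN.assign
    by_cases h : r = i
    · subst h
      have h1 : (Matrix.updateRow 1 r a).mulVec s r = a ⬝ᵥ s := by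
        simp only [Matrix.mulVec, Matrix.updateRow_self]
      simp [h1, a, add_dotProduct]
    · have h1 : (Matrix.updateRow 1 i a).mulVec s r = s r := by
        have h2 : (1 : Matrix (Fin d) (Fin d) ℝ).mulVec s r = s r := by simp
        rw [← h2]
        simp only [Matrix.mulVec, Matrix.updateRow_ne h]
      rw [Pi.add_apply, h1, Function.update_of_ne h, Function.update_of_ne h, Pi.zero_apply,
        add_zero, relu_of_nonneg (hs r)]

/-- `L` layers as in `Precomp` transform every nonnegative vector `s` into a vector `t` such
that `R s t`. -/
def Runs (d L : ℕ) (R : (Fin d → ℝ) → (Fin d → ℝ) → Prop) : Prop :=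
  ∃ F, Precomp d L F ∧ ∀ s, 0 ≤ s → R s (F s)

lemma Runs.comp {d L L' : ℕ} {R R' R'' : (Fin d → ℝ) → (Fin d → ℝ) → Prop} (h : Runs d L R)
    (h' : Runs d L' R')
    (H : ∀ s t r, 0 ≤ s → 0 ≤ t → 0 ≤ r → R s t → R' t r → R'' s r) :
    Runs d (L + L') R'' := by
  obtain ⟨F, hF, h⟩ := h
  obtain ⟨F', hF', h'⟩ := h'
  exact ⟨_, hF.comp hF', fun s hs =>
    H s _ _ hs (hF.1 s hs) (hF'.1 _ (hF.1 s hs)) (h s hs) (h' _ (hF.1 s hs))⟩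

end DNN

/-! ### Approximate multiplication -/

/-- The tent map, on the unit interval. -/
noncomputable def tent (z : ℝ) : ℝ := relu (2 * z - 2 * relu (2 * z - 1))

/-- Approximations to `z - z ^ 2`, obtained by iterating the tent map. -/
noncomputable def parabolaApprox : ℕ → ℝ → ℝ
  | 0, _ => 0
  | k + 1, z => (tent z + parabolaApprox k (tent z)) / 4

/-- Approximate product of `y` and `p`. -/
noncomputable def mulApprox (k : ℕ) (y p : ℝ) : ℝ :=
  |y + p| / 2 - |y - p| / 2 - parabolaApprox k (|y + p| / 2) + parabolaApprox k (|y - p| / 2)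

/-- The Horner scheme for `∑ j, a j * y ^ (j + 1)`. -/
def horner (y : ℝ) : List ℝ → ℝ
  | [] => 0
  | a :: l => y * (a + horner y l)

/-- The Horner scheme with approximate multiplications. -/
noncomputable def hornerApprox (k : ℕ) (y : ℝ) : List ℝ → ℝ
  | [] => 0
  | a :: l => mulApprox k y (a + hornerApprox k y l)

lemma tent_mem {z : ℝ} (h0 : 0 ≤ z) (h1 : z ≤ 1) :
    0 ≤ tent z ∧ tent z ≤ 1 ∧ z - z ^ 2 = (tent z + (tent z - tent z ^ 2)) / 4 := by
  unfold tent
  rcases le_total (2 * z) 1 with h | h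
  · have : relu (2 * z - 1) = 0 := max_eq_right (by linarith)
    rw [this, relu_of_nonneg (by linarith)]
    exact ⟨by linarith, by linarith, by ring⟩
  · rw [relu_of_nonneg (x := 2 * z - 1) (by linarith), relu_of_nonneg (by linarith)]
    exact ⟨by linarith, by linarith, by ring⟩

/-- By `tent_mem`, `z - z ^ 2` satisfies the recursion defining the approximation, so every step
divides the error by 4, starting from `z - z ^ 2 ≤ 1 / 4`. -/
lemma parabolaApprox_bound (k : ℕ) {z : ℝ} (h0 : 0 ≤ z) (h1 : z ≤ 1) :
    0 ≤ z - z ^ 2 - parabolaApprox k z ∧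
      z - z ^ 2 - parabolaApprox k z ≤ (1 / 4 : ℝ) ^ (k + 1) := by
  induction k generalizing z with
  | zero =>
    simp only [parabolaApprox]
    constructor <;> nlinarith [sq_nonneg (z - 1 / 2)]
  | succ k ih =>
    obtain ⟨t0, t1, e⟩ := tent_mem h0 h1
    obtain ⟨i0, i1⟩ := ih t0 t1
    rw [e, parabolaApprox, pow_succ _ (k + 1)]
    constructor <;> linarith

/-- Both squares are approximated with errors of the same sign, so the errors of their difference do
not add up. -/
lemma mulApprox_bound (k : ℕ) {y p : ℝ} (hy : |y| ≤ 1) (hp : |p| ≤ 1) :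
    |mulApprox k y p - y * p| ≤ (1 / 4 : ℝ) ^ (k + 1) := by
  have e : y * p = (|y + p| / 2) ^ 2 - (|y - p| / 2) ^ 2 := by
    rw [div_pow, div_pow, sq_abs, sq_abs]; ring
  have h1 := parabolaApprox_bound k (z := |y + p| / 2) (by positivity)
    (by linarith [abs_add_le y p])
  have h2 := parabolaApprox_bound k (z := |y - p| / 2) (by positivity)
    (by linarith [abs_sub y p])
  rw [e, mulApprox, abs_le]
  constructor <;> linarith

/-- Multiplication by `y ≤ 1 / 4` contracts: with `q = 4 ^ (-(k + 1))` the error obeys `q + 2 * q /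
4 ≤ 2 * q`, independently of the degree. The bound `1 / 2` on the value keeps the next factor in
`[-1, 1]`. -/
lemma hornerApprox_bound (k : ℕ) {y : ℝ} (h0 : 0 ≤ y) (h1 : y ≤ 1 / 4) (l : List ℝ)
    (hl : ∀ a ∈ l, |a| ≤ 1 / 2) :
    |hornerApprox k y l| ≤ 1 / 2 ∧
      |hornerApprox k y l - horner y l| ≤ 2 * (1 / 4 : ℝ) ^ (k + 1) := by
  induction l with
  | nil => simp [horner, hornerApprox]
  | cons a l ih =>
    obtain ⟨i0, i1⟩ := ih fun b hb => hl b (List.mem_cons_of_mem _ hb)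
    have ha := hl a List.mem_cons_self
    have hq : (1 / 4 : ℝ) ^ (k + 1) ≤ 1 / 4 := by
      rw [pow_succ]
      have := pow_le_one₀ (n := k) (show (0 : ℝ) ≤ 1 / 4 by norm_num) (by norm_num)
      linarith
    have hq0 : 0 ≤ (1 / 4 : ℝ) ^ (k + 1) := by positivity
    have hp : |a + hornerApprox k y l| ≤ 1 := by linarith [abs_add_le a (hornerApprox k y l)]
    have hm := mulApprox_bound k (y := y) (by rw [abs_of_nonneg h0]; linarith) hp
    simp only [horner, hornerApprox]
    set p := a + hornerApprox k y l
    have hyp : |y * p| ≤ 1 / 4 := by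
      rw [abs_mul, abs_of_nonneg h0]; nlinarith [abs_nonneg p]
    have hd : |y * p - y * (a + horner y l)| ≤ 1 / 4 * (2 * (1 / 4 : ℝ) ^ (k + 1)) := by
      rw [show y * p - y * (a + horner y l) = y * (hornerApprox k y l - horner y l) by
        simp only [p]; ring, abs_mul, abs_of_nonneg h0]
      gcongr
    constructor
    · linarith [abs_sub_abs_le_abs_sub (mulApprox k y p) (y * p)]
    · linarith [abs_sub_le (mulApprox k y p) (y * p) (y * (a + horner y l))]

/-! ### The program evaluating a piecewise polynomial

The registers are: `0`, `1` the positive and negative part of the input; `2` the part of the input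
not yet processed; `3` the local variable; `4`, `5`, `6` scratch; `7`, `8` the positive and
negative part of the current value of the Horner scheme; `9`, `10` and `11`, `12` the two
accumulators, each stored as a difference. -/

namespace DNN

lemma runs_tent {c : ℝ} (hc : 0 ≤ c) (hc1 : c ≤ 1) :
    Runs 13 6 fun s t => t 4 = tent (s 4) ∧ t 5 = tent (s 5) ∧ t 7 = s 7 + c * tent (s 5) ∧
      t 8 = s 8 + c * tent (s 4) ∧
      ∀ j ∈ ({0, 1, 2, 3, 9, 10, 11, 12} : Finset (Fin 13)), t j = s j := by
  have hc2 : |c| ≤ 2 := by rw [abs_of_nonneg hc]; linarith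
  refine ⟨_, ((((((Precomp.assign 6 4 0 1 (α := 2) (β := 0) (γ := 0) (b := -1)).comp
    (Precomp.assign 4 4 6 0 (α := 2) (β := -2) (γ := 0) (b := 0))).comp
    (Precomp.assign 6 5 0 1 (α := 2) (β := 0) (γ := 0) (b := -1))).comp
    (Precomp.assign 5 5 6 0 (α := 2) (β := -2) (γ := 0) (b := 0))).comp
    (Precomp.assign 7 7 5 0 (α := 1) (β := c) (γ := 0) (b := 0) (hβ := hc2))).comp
    (Precomp.assign 8 8 4 0 (α := 1) (β := c) (γ := 0) (b := 0) (hβ := hc2))), fun s hs => ?_⟩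
  have h4 : 0 ≤ s 8 + c * tent (s 4) := add_nonneg (hs 8) (mul_nonneg hc (relu_nonneg _))
  have h5 : 0 ≤ s 7 + c * tent (s 5) := add_nonneg (hs 7) (mul_nonneg hc (relu_nonneg _))
  beta_reduce
  rw [← relu_of_nonneg h4, ← relu_of_nonneg h5]
  simp [DNN.assign, tent, sub_eq_add_neg]

/-- The weight `c` is general because each tent iteration passes `c / 4` on to the next. Registers 4
and 5 feed 8 and 7 crosswise, which gives the signs in `mulApprox` without any subtraction. -/
lemma runs_parabola (k : ℕ) {c : ℝ} (hc : 0 ≤ c) (hc1 : c ≤ 1) :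
    Runs 13 (6 * k) fun s t => t 7 = s 7 + c * parabolaApprox k (s 5) ∧
      t 8 = s 8 + c * parabolaApprox k (s 4) ∧
      ∀ j ∈ ({0, 1, 2, 3, 9, 10, 11, 12} : Finset (Fin 13)), t j = s j := by
  induction k generalizing c with
  | zero => exact ⟨_, Precomp.id, by simp [parabolaApprox]⟩
  | succ k ih =>
    rw [show 6 * (k + 1) = 6 + 6 * k by ring]
    refine (runs_tent (c := c / 4) (by positivity) (by linarith)).comp
      (ih (c := c / 4) (by positivity) (by linarith)) ?_
    rintro s t r - - - ⟨t4, t5, t7, t8, tj⟩ ⟨r7, r8, rj⟩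
    refine ⟨?_, ?_, fun j hj => (rj j hj).trans (tj j hj)⟩
    · rw [r7, t7, t5, parabolaApprox]; ring
    · rw [r8, t8, t4, parabolaApprox]; ring

lemma runs_mulInit {a : ℝ} (ha : |a| ≤ 2) :
    Runs 13 8 fun s t => t 4 = |s 3 + (a + (s 7 - s 8))| / 2 ∧
      t 5 = |s 3 - (a + (s 7 - s 8))| / 2 ∧ t 7 = |s 3 + (a + (s 7 - s 8))| / 2 ∧
      t 8 = |s 3 - (a + (s 7 - s 8))| / 2 ∧
      ∀ j ∈ ({0, 1, 2, 3, 9, 10, 11, 12} : Finset (Fin 13)), t j = s j := by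
  have hp : |a / 2| ≤ 2 := by rw [abs_div, abs_two]; linarith [abs_nonneg a]
  have hn : |-(a / 2)| ≤ 2 := by rwa [abs_neg]
  refine ⟨_, ((((((((Precomp.assign 6 3 7 8 (α := 1 / 2) (β := 1 / 2) (γ := -(1 / 2))
      (b := a / 2) (hb := hp)).comp
    (Precomp.assign 4 3 7 8 (α := -(1 / 2)) (β := -(1 / 2)) (γ := 1 / 2)
      (b := -(a / 2)) (hb := hn))).comp
    (Precomp.assign 4 6 4 0 (α := 1) (β := 1) (γ := 0) (b := 0))).comp
    (Precomp.assign 6 3 7 8 (α := 1 / 2) (β := -(1 / 2)) (γ := 1 / 2)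
      (b := -(a / 2)) (hb := hn))).comp
    (Precomp.assign 5 3 7 8 (α := -(1 / 2)) (β := 1 / 2) (γ := -(1 / 2))
      (b := a / 2) (hb := hp))).comp
    (Precomp.assign 5 6 5 0 (α := 1) (β := 1) (γ := 0) (b := 0))).comp
    (Precomp.assign 7 4 0 1 (α := 1) (β := 0) (γ := 0) (b := 0))).comp
    (Precomp.assign 8 5 0 1 (α := 1) (β := 0) (γ := 0) (b := 0))), fun s hs => ?_⟩
  have key : ∀ x : ℝ, |x| / 2 = relu (x / 2) + relu (-(x / 2)) := fun x => by
    rw [relu_add_relu_neg, abs_div, abs_two]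
  have h1 := key (s 3 + (a + (s 7 - s 8)))
  have h2 := key (s 3 - (a + (s 7 - s 8)))
  rw [show (s 3 + (a + (s 7 - s 8))) / 2 = 1 / 2 * s 3 + 1 / 2 * s 7 + -(1 / 2) * s 8 + a / 2 by
      ring, show -(1 / 2 * s 3 + 1 / 2 * s 7 + -(1 / 2) * s 8 + a / 2)
      = -(1 / 2) * s 3 + -(1 / 2) * s 7 + 1 / 2 * s 8 + -(a / 2) by ring] at h1
  rw [show (s 3 - (a + (s 7 - s 8))) / 2 = 1 / 2 * s 3 + -(1 / 2) * s 7 + 1 / 2 * s 8 + -(a / 2) by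
      ring, show -(1 / 2 * s 3 + -(1 / 2) * s 7 + 1 / 2 * s 8 + -(a / 2))
      = -(1 / 2) * s 3 + 1 / 2 * s 7 + -(1 / 2) * s 8 + a / 2 by ring] at h2
  have h3 := relu_of_nonneg (add_nonneg (relu_nonneg _) (relu_nonneg _) |>.trans_eq h1.symm)
  have h4 := relu_of_nonneg (add_nonneg (relu_nonneg _) (relu_nonneg _) |>.trans_eq h2.symm)
  rw [h1] at h3
  rw [h2] at h4
  beta_reduce
  rw [h1, h2]
  simp only [DNN.assign]
  simp [-one_div, -neg_mul, h3, h4]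

lemma runs_mul (k : ℕ) {a : ℝ} (ha : |a| ≤ 2) :
    Runs 13 (8 + 6 * k) fun s t =>
      t 7 - t 8 = mulApprox k (s 3) (a + (s 7 - s 8)) ∧
      ∀ j ∈ ({0, 1, 2, 3, 9, 10, 11, 12} : Finset (Fin 13)), t j = s j := by
  refine (runs_mulInit ha).comp (runs_parabola k (c := 1) (by norm_num) le_rfl) ?_
  rintro s t r - - - ⟨t4, t5, t7, t8, tj⟩ ⟨r7, r8, rj⟩
  refine ⟨?_, fun j hj => (rj j hj).trans (tj j hj)⟩
  rw [r7, r8, t7, t8, t4, t5, mulApprox]; ring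

lemma runs_horner (k : ℕ) (l : List ℝ) (hl : ∀ a ∈ l, |a| ≤ 2) :
    Runs 13 (2 + l.length * (8 + 6 * k)) fun s t =>
      t 7 - t 8 = hornerApprox k (s 3) l ∧
      ∀ j ∈ ({0, 1, 2, 3, 9, 10, 11, 12} : Finset (Fin 13)), t j = s j := by
  induction l with
  | nil =>
    rw [List.length_nil, zero_mul]
    refine ⟨_, (Precomp.assign (d := 13) 7 0 1 2 (α := 0) (β := 0) (γ := 0) (b := 0)).comp
      (Precomp.assign (d := 13) 8 0 1 2 (α := 0) (β := 0) (γ := 0) (b := 0)), fun s hs => ?_⟩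
    simp [DNN.assign, hornerApprox]
  | cons a l ih =>
    rw [List.length_cons, show 2 + (l.length + 1) * (8 + 6 * k)
      = 2 + l.length * (8 + 6 * k) + (8 + 6 * k) by ring]
    refine (ih fun b hb => hl b (List.mem_cons_of_mem _ hb)).comp
      (runs_mul k (hl a List.mem_cons_self)) ?_
    rintro s t r - - - ⟨t7, tj⟩ ⟨r7, rj⟩
    refine ⟨?_, fun j hj => (rj j hj).trans (tj j hj)⟩
    rw [r7, t7, tj 3 (by decide), hornerApprox]

/-- Splits the unprocessed length into its part in the current piece and the remainder, via `min z h
= z - relu (z - h)` for `z ≥ 0`. -/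
lemma runs_clip {h : ℝ} (h0 : 0 ≤ h) (h1 : h ≤ 2) :
    Runs 13 3 fun s t => t 3 = min (s 2) h ∧ t 2 = relu (s 2 - h) ∧
      ∀ j ∈ ({0, 1, 9, 10, 11, 12} : Finset (Fin 13)), t j = s j := by
  refine ⟨_, ((Precomp.assign 6 2 0 1 (α := 1) (β := 0) (γ := 0) (b := -h)
      (hb := by rwa [abs_neg, abs_of_nonneg h0])).comp
    (Precomp.assign 3 2 6 0 (α := 1) (β := -1) (γ := 0) (b := 0))).comp
    (Precomp.assign 2 6 0 1 (α := 1) (β := 0) (γ := 0) (b := 0)), fun s hs => ?_⟩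
  have key : min (s 2) h = relu (s 2 - relu (s 2 - h)) := by
    have h2 : 0 ≤ s 2 := hs 2
    rcases le_total (s 2) h with hh | hh
    · rw [min_eq_left hh, show relu (s 2 - h) = 0 from max_eq_right (by linarith),
        relu_of_nonneg (by linarith), sub_zero]
    · rw [min_eq_right hh, relu_of_nonneg (x := s 2 - h) (by linarith),
        relu_of_nonneg (by linarith)]; ring
  beta_reduce
  rw [key]
  simp [DNN.assign, sub_eq_add_neg, relu_of_nonneg (relu_nonneg _)]

lemma runs_accumulate :
    Runs 13 4 fun s t => t 9 - t 10 = s 9 - s 10 + 2 * (s 7 - s 8) ∧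
      ∀ j ∈ ({0, 1, 2, 11, 12} : Finset (Fin 13)), t j = s j := by
  refine ⟨_, (((Precomp.assign 6 7 8 0 (α := 2) (β := -2) (γ := 0) (b := 0)).comp
    (Precomp.assign 9 9 6 0 (α := 1) (β := 1) (γ := 0) (b := 0))).comp
    (Precomp.assign 6 7 8 0 (α := -2) (β := 2) (γ := 0) (b := 0))).comp
    (Precomp.assign 10 10 6 0 (α := 1) (β := 1) (γ := 0) (b := 0)), fun s hs => ?_⟩
  have key := relu_sub_relu_neg (2 * s 7 + -2 * s 8)
  rw [show -(2 * s 7 + -2 * s 8) = -2 * s 7 + 2 * s 8 by ring] at key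
  have h1 := relu_of_nonneg (add_nonneg (hs 9) (relu_nonneg (2 * s 7 + -2 * s 8)))
  have h2 := relu_of_nonneg (add_nonneg (hs 10) (relu_nonneg (-2 * s 7 + 2 * s 8)))
  simp only [DNN.assign]
  simp [-neg_mul] at h1 h2 ⊢
  rw [h1, h2]
  linarith

lemma runs_piece (k : ℕ) {h : ℝ} (h0 : 0 ≤ h) (h1 : h ≤ 2) (l : List ℝ) (hl : ∀ a ∈ l, |a| ≤ 2) :
    Runs 13 (9 + l.length * (8 + 6 * k)) fun s t =>
      t 9 - t 10 = s 9 - s 10 + 2 * hornerApprox k (min (s 2) h) l ∧ t 2 = relu (s 2 - h) ∧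
      ∀ j ∈ ({0, 1, 11, 12} : Finset (Fin 13)), t j = s j := by
  rw [show 9 + l.length * (8 + 6 * k) = 3 + (2 + l.length * (8 + 6 * k)) + 4 by ring]
  refine Runs.comp (R := fun s t => t 7 - t 8 = hornerApprox k (min (s 2) h) l ∧
    t 2 = relu (s 2 - h) ∧ ∀ j ∈ ({0, 1, 9, 10, 11, 12} : Finset (Fin 13)), t j = s j)
    ((runs_clip h0 h1).comp (runs_horner k l hl) ?_) runs_accumulate ?_
  · rintro s t r - - - ⟨t3, t2, tj⟩ ⟨r7, rj⟩
    refine ⟨by rw [r7, t3], by rw [rj 2 (by decide), t2], fun j hj => ?_⟩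
    rw [rj j (by revert j; decide), tj j hj]
  · rintro s t r - - - ⟨t7, t2, tj⟩ ⟨r9, rj⟩
    refine ⟨by rw [r9, t7, tj 9 (by decide), tj 10 (by decide)],
      by rw [rj 2 (by decide), t2], fun j hj => ?_⟩
    rw [rj j (by revert j; decide), tj j (by revert j; decide)]

lemma runs_pieces (k n : ℕ) {h : ℝ} (h0 : 0 ≤ h) (h1 : h ≤ 2) (l : ℕ → List ℝ)
    (hn : ∀ i, (l i).length = n) (M : ℕ) (hl : ∀ i < M, ∀ a ∈ l i, |a| ≤ 2) :
    Runs 13 (M * (9 + n * (8 + 6 * k))) fun s t =>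
      t 9 - t 10 = s 9 - s 10 +
        2 * ∑ i ∈ Finset.range M, hornerApprox k (min (relu (s 2 - i * h)) h) (l i) ∧
      t 2 = relu (s 2 - M * h) ∧
      ∀ j ∈ ({0, 1, 11, 12} : Finset (Fin 13)), t j = s j := by
  induction M with
  | zero =>
    rw [zero_mul]
    refine ⟨_, Precomp.id, fun s hs => ?_⟩
    simp [relu_of_nonneg (hs 2)]
  | succ M ih =>
    have := runs_piece k h0 h1 (l M) (hl M M.lt_succ_self)
    rw [hn M] at this
    rw [add_one_mul]
    refine (ih fun i hi => hl i (hi.trans M.lt_succ_self)).comp this ?_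
    rintro s t r - - - ⟨t9, t2, tj⟩ ⟨r9, r2, rj⟩
    refine ⟨?_, ?_, fun j hj => (rj j hj).trans (tj j hj)⟩
    · rw [r9, t9, t2, Finset.sum_range_succ]; ring
    -- Clipping twice is clipping once: `relu (relu (u - M * h) - h) = relu (u - (M + 1) * h)`.
    · rw [r2, t2]
      push_cast
      unfold relu
      rcases le_total (s 2 - M * h) 0 with hh | hh
      · rw [max_eq_right hh, max_eq_right, max_eq_right] <;> linarith
      · rw [max_eq_left hh]; congr 1; ring

end DNN

/-! ### Programs for both sides of the origin -/

namespace DNN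

lemma runs_copy (i : Fin 13) (hi : i ∈ ({0, 1} : Finset (Fin 13))) :
    Runs 13 1 fun s t => t 2 = s i ∧
      ∀ j ∈ ({0, 1, 9, 10, 11, 12} : Finset (Fin 13)), t j = s j := by
  refine ⟨_, Precomp.assign 2 i 3 4 (α := 1) (β := 0) (γ := 0) (b := 0)
    (hjk := by revert i; decide) (hjl := by revert i; decide), fun s hs => ?_⟩
  simp [DNN.assign, relu_of_nonneg (hs i)]

lemma runs_const {c : ℝ} (hc : |c| ≤ 2) :
    Runs 13 2 fun s t => t 9 - t 10 = c ∧
      ∀ j ∈ ({0, 1, 11, 12} : Finset (Fin 13)), t j = s j := by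
  refine ⟨_, (Precomp.assign (d := 13) 9 0 1 2 (α := 0) (β := 0) (γ := 0) (b := c)
    (hb := hc)).comp (Precomp.assign (d := 13) 10 0 1 2 (α := 0) (β := 0) (γ := 0) (b := -c)
    (hb := by rwa [abs_neg])), fun s hs => ?_⟩
  simp [DNN.assign, relu_sub_relu_neg]

lemma runs_twoSided (k n : ℕ) {c h : ℝ} (hc : |c| ≤ 2) (h0 : 0 ≤ h) (h1 : h ≤ 2)
    (l l' : ℕ → List ℝ) (hn : ∀ i, (l i).length = n) (hn' : ∀ i, (l' i).length = n) (M : ℕ)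
    (hl : ∀ i < M, ∀ a ∈ l i, |a| ≤ 2) (hl' : ∀ i < M, ∀ a ∈ l' i, |a| ≤ 2) :
    Runs 13 (4 + 2 * (M * (9 + n * (8 + 6 * k)))) fun s t =>
      t 9 - t 10 = c +
        2 * ∑ i ∈ Finset.range M, hornerApprox k (min (relu (s 0 - i * h)) h) (l i) +
        2 * ∑ i ∈ Finset.range M, hornerApprox k (min (relu (s 1 - i * h)) h) (l' i) ∧
      ∀ j ∈ ({0, 1, 11, 12} : Finset (Fin 13)), t j = s j := by
  have side : ∀ (r : Fin 13), r ∈ ({0, 1} : Finset (Fin 13)) → ∀ l : ℕ → List ℝ,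
      (∀ i, (l i).length = n) → (∀ i < M, ∀ a ∈ l i, |a| ≤ 2) →
      Runs 13 (1 + M * (9 + n * (8 + 6 * k))) fun s t =>
        t 9 - t 10 = s 9 - s 10 +
          2 * ∑ i ∈ Finset.range M, hornerApprox k (min (relu (s r - i * h)) h) (l i) ∧
        ∀ j ∈ ({0, 1, 11, 12} : Finset (Fin 13)), t j = s j := by
    intro r hr l hn hl
    refine (runs_copy r hr).comp (runs_pieces k n h0 h1 l hn M hl) ?_
    rintro s t r - - - ⟨t2, tj⟩ ⟨r9, -, rj⟩
    refine ⟨by rw [r9, t2, tj 9 (by decide), tj 10 (by decide)], fun j hj => ?_⟩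
    rw [rj j hj, tj j (by revert j; decide)]
  rw [show 4 + 2 * (M * (9 + n * (8 + 6 * k)))
    = 2 + (1 + M * (9 + n * (8 + 6 * k))) + (1 + M * (9 + n * (8 + 6 * k))) by ring]
  refine Runs.comp (R := fun s t => t 9 - t 10 = c +
      2 * ∑ i ∈ Finset.range M, hornerApprox k (min (relu (s 0 - i * h)) h) (l i) ∧
      ∀ j ∈ ({0, 1, 11, 12} : Finset (Fin 13)), t j = s j)
    ((runs_const hc).comp (side 0 (by decide) l hn hl) ?_) (side 1 (by decide) l' hn' hl') ?_
  · rintro s t r - - - ⟨t9, tj⟩ ⟨r9, rj⟩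
    exact ⟨by rw [r9, t9, tj 0 (by decide)], fun j hj => (rj j hj).trans (tj j hj)⟩
  · rintro s t r - - - ⟨t9, tj⟩ ⟨r9, rj⟩
    exact ⟨by rw [r9, t9, tj 1 (by decide)], fun j hj => (rj j hj).trans (tj j hj)⟩

end DNN

/-! ### Local Taylor approximation -/

/-- Smooth real functions on `(-D, D)` whose `j`-th derivative is bounded by `lam j`. -/
def DerivBounds (lam : ℕ → ℝ) (D : ℝ) (g : ℝ → ℝ) : Prop :=
  (∀ x ∈ Set.Ioo (-D) D, ContDiffAt ℝ ∞ g x) ∧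
    ∀ j, ∀ x ∈ Set.Ioo (-D) D, |iteratedDeriv j g x| ≤ lam j

lemma contDiffAt_of_mem_smoothClass {E : Type*} [NormedAddCommGroup E] [NormedSpace ℝ E]
    {lam : ℕ → ℝ} {D : ℝ} {f : ℝ → E} (hf : f ∈ smoothClass lam D E) {x : ℝ}
    (hx : x ∈ Set.Ioo (-D) D) : ContDiffAt ℝ ∞ f x :=
  hf.1.contDiffAt (Icc_mem_nhds hx.1 hx.2)

lemma norm_iteratedDeriv_le_of_mem_smoothClass {E : Type*} [NormedAddCommGroup E]
    [NormedSpace ℝ E] {lam : ℕ → ℝ} {D : ℝ} {f : ℝ → E} (hf : f ∈ smoothClass lam D E) (j : ℕ)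
    {x : ℝ} (hx : x ∈ Set.Ioo (-D) D) : ‖iteratedDeriv j f x‖ ≤ lam j := by
  have h := hf.2 j x hx
  rwa [iteratedDerivWithin_eq_iteratedDeriv (uniqueDiffOn_Icc (hx.1.trans hx.2))
    ((contDiffAt_of_mem_smoothClass hf hx).of_le (by exact_mod_cast le_top))
    (Set.Ioo_subset_Icc_self hx)] at h

/-- Reduces to real functions: `T` will be the identity, the real part or the imaginary part. -/
lemma DerivBounds.clm_comp {E : Type*} [NormedAddCommGroup E] [NormedSpace ℝ E]
    {lam : ℕ → ℝ} {D : ℝ} {f : ℝ → E} (hf : f ∈ smoothClass lam D E) (T : E →L[ℝ] ℝ)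
    (hT : ∀ v, |T v| ≤ ‖v‖) : DerivBounds lam D (fun x => T (f x)) := by
  refine ⟨fun x hx => T.contDiff.contDiffAt.comp x (contDiffAt_of_mem_smoothClass hf hx),
    fun j x hx => ?_⟩
  have h : iteratedDeriv j (fun x => T (f x)) x = T (iteratedDeriv j f x) := by
    have := T.iteratedFDeriv_comp_left (contDiffAt_of_mem_smoothClass hf hx) (i := j)
      (by exact_mod_cast le_top)
    rw [iteratedDeriv, iteratedDeriv]
    change iteratedFDeriv ℝ j (T ∘ f) x _ = _
    rw [this]
    rfl
  rw [h]
  exact (hT _).trans (norm_iteratedDeriv_le_of_mem_smoothClass hf j hx)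

lemma DerivBounds.comp_neg {lam : ℕ → ℝ} {D : ℝ} {g : ℝ → ℝ} (hg : DerivBounds lam D g) :
    DerivBounds lam D (fun x => g (-x)) := by
  have hm : ∀ x ∈ Set.Ioo (-D) D, -x ∈ Set.Ioo (-D) D := fun x hx =>
    ⟨by linarith [hx.2], by linarith [hx.1]⟩
  refine ⟨fun x hx => (hg.1 _ (hm x hx)).comp x contDiff_neg.contDiffAt, fun j x hx => ?_⟩
  rw [iteratedDeriv_comp_neg, smul_eq_mul, abs_mul, abs_pow, abs_neg, abs_one, one_pow, one_mul]
  exact hg.2 j _ (hm x hx)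

lemma DerivBounds.taylor {lam : ℕ → ℝ} {D : ℝ} {g : ℝ → ℝ} (hg : DerivBounds lam D g) (n : ℕ)
    {x y : ℝ} (hx : -D < x) (hy : 0 ≤ y) (hxy : x + y < D) :
    |g (x + y) - ∑ j ∈ Finset.range (n + 1), iteratedDeriv j g x / j.factorial * y ^ j|
      ≤ lam (n + 1) * y ^ (n + 1) / n.factorial := by
  rcases hy.eq_or_lt with rfl | hy
  · simp [Finset.sum_range_succ']
  have hsub : ∀ z ∈ Set.Icc x (x + y), z ∈ Set.Ioo (-D) D := fun z hz =>
    ⟨hx.trans_le hz.1, hz.2.trans_lt hxy⟩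
  have hu := uniqueDiffOn_Icc (show x < x + y by linarith)
  have hd : ∀ (j : ℕ), ∀ z ∈ Set.Icc x (x + y),
      iteratedDerivWithin j g (Set.Icc x (x + y)) z = iteratedDeriv j g z := fun j z hz =>
    iteratedDerivWithin_eq_iteratedDeriv hu
      ((hg.1 z (hsub z hz)).of_le (by exact_mod_cast le_top)) hz
  have hxm : x ∈ Set.Icc x (x + y) := ⟨le_rfl, by linarith⟩
  have := taylor_mean_remainder_bound (f := g) (a := x) (b := x + y) (x := x + y) (n := n)
    (C := lam (n + 1)) (by linarith)
    (fun z hz => ((hg.1 z (hsub z hz)).of_le (by exact_mod_cast le_top)).contDiffWithinAt)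
    ⟨by linarith, le_rfl⟩
    (fun z hz => by rw [hd _ z hz]; exact hg.2 _ z (hsub z hz))
  rw [taylor_within_apply, Real.norm_eq_abs, add_sub_cancel_left] at this
  convert this using 4 with j
  rw [hd j x hxm, smul_eq_mul]
  ring

lemma horner_range_map (n : ℕ) (a : ℕ → ℝ) (y : ℝ) :
    horner y ((List.range n).map a) = ∑ j ∈ Finset.range n, a j * y ^ (j + 1) := by
  induction n generalizing a with
  | zero => simp [horner]
  | succ n ih =>
    rw [List.range_succ_eq_map, List.map_cons, List.map_map, horner, ih, Finset.sum_range_succ',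
      mul_add, Finset.mul_sum, add_comm]
    congr 1
    · exact Finset.sum_congr rfl fun j _ => by simp only [Function.comp, Nat.succ_eq_add_one]; ring
    · ring

/-- The coefficients of the `n`-th Taylor polynomial of `g` at `x`, without the constant term,
divided by `2 * c`. -/
noncomputable def taylorCoeffs (g : ℝ → ℝ) (c : ℝ) (n : ℕ) (x : ℝ) : List ℝ :=
  (List.range n).map fun j => iteratedDeriv (j + 1) g x / (j + 1).factorial / (2 * c)

lemma abs_taylorCoeffs_le {lam : ℕ → ℝ} (hlam : Monotone lam) {D : ℝ} {g : ℝ → ℝ}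
    (hg : DerivBounds lam D g) {n : ℕ} (hn : 0 < lam n) {x : ℝ} (hx : x ∈ Set.Ioo (-D) D) :
    ∀ a ∈ taylorCoeffs g (lam n) n x, |a| ≤ 1 / 2 := by
  intro a ha
  obtain ⟨j, hj, rfl⟩ := List.mem_map.1 ha
  rw [List.mem_range] at hj
  have h1 : (1 : ℝ) ≤ (j + 1).factorial := by exact_mod_cast Nat.factorial_pos _
  have h2 : |iteratedDeriv (j + 1) g x| ≤ lam n := (hg.2 _ x hx).trans (hlam hj)
  rw [abs_div, abs_div, abs_of_nonneg (zero_le_one.trans h1),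
    abs_of_pos (show 0 < 2 * lam n by positivity), div_div, div_le_iff₀ (by positivity)]
  nlinarith

lemma DerivBounds.horner_taylor {lam : ℕ → ℝ} {D : ℝ} {g : ℝ → ℝ} (hg : DerivBounds lam D g)
    {n : ℕ} (hn : 0 < lam n) {x y : ℝ} (hx : -D < x) (hy : 0 ≤ y) (hxy : x + y < D) :
    |lam n * (2 * horner y (taylorCoeffs g (lam n) n x)) - (g (x + y) - g x)|
      ≤ lam (n + 1) * y ^ (n + 1) / n.factorial := by
  have := hg.taylor n hx hy hxy
  rw [abs_sub_comm, Finset.sum_range_succ'] at this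
  have e : lam n * (2 * horner y (taylorCoeffs g (lam n) n x)) =
      ∑ j ∈ Finset.range n, iteratedDeriv (j + 1) g x / (j + 1).factorial * y ^ (j + 1) := by
    rw [taylorCoeffs, horner_range_map, Finset.mul_sum, Finset.mul_sum]
    refine Finset.sum_congr rfl fun j _ => ?_
    field_simp
  convert this using 2
  rw [e, iteratedDeriv_zero, pow_zero, Nat.factorial_zero, Nat.cast_one]
  ring

/-- Increments of `g` add up along a subdivision of `[0, D]` into pieces of length `h`. -/
lemma sum_increments {g : ℝ → ℝ} {D h θ : ℝ} (hh : 0 < h) {M : ℕ} (hM : M * h ≤ D)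
    (T : ℕ → ℝ → ℝ)
    (hT : ∀ i < M, ∀ y, 0 ≤ y → y ≤ h → i * h + y < D →
      |T i y - (g (i * h + y) - g (i * h))| ≤ θ) {u : ℝ} (hu0 : 0 ≤ u) (huD : u < D) :
    |∑ i ∈ Finset.range M, T i (min (relu (u - i * h)) h) - (g (min u (M * h)) - g 0)| ≤ M * θ := by
  induction M with
  | zero => simp [hu0]
  | succ M ih =>
    push_cast at hM ⊢
    have hM' : M * h < D := by nlinarith
    have ih := ih hM'.le fun i hi => hT i (hi.trans M.lt_succ_self)
    have hT := hT M M.lt_succ_self (min (relu (u - M * h)) h)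
      (le_min (relu_nonneg _) hh.le) (min_le_right _ _)
    -- The telescoping step: the new increment is zero if `u ≤ M * h`, and otherwise extends the
    -- range to `min u ((M + 1) * h)`. Since `u < D`, the endpoint stays in the open interval where
    -- the bounds hold.
    have key : g (M * h + min (relu (u - M * h)) h) - g (M * h)
        = g (min u ((M + 1) * h)) - g (min u (M * h)) ∧
        M * h + min (relu (u - M * h)) h < D := by
      rcases le_total u (M * h) with hu | hu
      · have : relu (u - M * h) = 0 := max_eq_right (by linarith)
        rw [this, min_eq_left hh.le, min_eq_left hu, min_eq_left (by linarith)]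
        simpa using hM'
      · rw [relu_of_nonneg (by linarith), min_eq_right hu, ← min_add_add_left]
        constructor
        · congr 3 <;> ring
        · exact (min_le_left _ _).trans_lt (by linarith)
    have hT := hT key.2
    rw [key.1] at hT
    rw [Finset.sum_range_succ]
    rw [abs_le] at *
    constructor <;> linarith [hT.1, hT.2, ih.1, ih.2]

/-- The function computed on one side of the origin approximates the increments of `g`. -/
lemma DerivBounds.sum_hornerApprox {lam : ℕ → ℝ} (hlam : Monotone lam) {D : ℝ} (hD : 0 < D)
    {g : ℝ → ℝ} (hg : DerivBounds lam D g) {n : ℕ} (hn : 0 < lam n) {M : ℕ} (hM : 0 < M)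
    (hM4 : 4 * D ≤ M) (k : ℕ) {u : ℝ} (hu0 : 0 ≤ u) (huD : u < D) :
    |lam n * (2 * ∑ i ∈ Finset.range M, hornerApprox k (min (relu (u - i * (D / M))) (D / M))
        (taylorCoeffs g (lam n) n (i * (D / M)))) - (g u - g 0)|
      ≤ M * (lam n * (1 / 4) ^ k + lam (n + 1) * (D / M) ^ (n + 1) / n.factorial) := by
  have hM' : (0 : ℝ) < M := by exact_mod_cast hM
  have hn' : 0 < lam (n + 1) := hn.trans_le (hlam n.le_succ)
  have hh : 0 < D / M := by positivity
  have hh4 : D / M ≤ 1 / 4 := by rw [div_le_iff₀ hM']; linarith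
  have hMh : M * (D / M) = D := by field_simp
  have := sum_increments (g := g) (u := u) hh hMh.le
    (fun i y => lam n * (2 * hornerApprox k y (taylorCoeffs g (lam n) n (i * (D / M)))))
    (θ := lam n * (1 / 4) ^ k + lam (n + 1) * (D / M) ^ (n + 1) / n.factorial)
    (fun i hi y hy0 hyh hyD => ?_) hu0 huD
  · rwa [hMh, min_eq_left huD.le, ← Finset.mul_sum, ← Finset.mul_sum] at this
  · have hx0 : 0 ≤ i * (D / M) := by positivity
    have h1 := hg.horner_taylor hn (x := i * (D / M)) (by linarith) hy0 hyD
    have h2 := (hornerApprox_bound k hy0 (hyh.trans hh4) _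
      (abs_taylorCoeffs_le hlam hg hn (x := i * (D / M)) ⟨by linarith, by linarith⟩)).2
    have h3 : lam (n + 1) * y ^ (n + 1) / n.factorial
        ≤ lam (n + 1) * (D / M) ^ (n + 1) / n.factorial := by gcongr
    set A := hornerApprox k y (taylorCoeffs g (lam n) n (i * (D / M)))
    set H := horner y (taylorCoeffs g (lam n) n (i * (D / M)))
    have h4 : |lam n * (2 * A) - lam n * (2 * H)| ≤ lam n * (1 / 4) ^ k := by
      rw [← mul_sub, ← mul_sub, abs_mul, abs_mul, abs_two, abs_of_pos hn]
      gcongr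
      rw [pow_succ] at h2
      linarith
    linarith [abs_sub_le (lam n * (2 * A)) (lam n * (2 * H)) (g (i * (D / M) + y) - g (i * (D / M)))]

open DNN in
/-- A program which approximates a function with bounded derivatives. -/
lemma DerivBounds.runs {lam : ℕ → ℝ} (hlam : Monotone lam) {D : ℝ} (hD : 0 < D)
    {g : ℝ → ℝ} (hg : DerivBounds lam D g) {n : ℕ} (hn : 0 < lam n) {M : ℕ} (hM : 0 < M)
    (hM4 : 4 * D ≤ M) (k : ℕ) {η : ℝ}
    (hη : 2 * (M * (lam n * (1 / 4) ^ k + lam (n + 1) * (D / M) ^ (n + 1) / n.factorial)) ≤ η) :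
    Runs 13 (4 + 2 * (M * (9 + n * (8 + 6 * k)))) fun s t =>
      (∀ x ∈ Set.Ioo (-D) D, s 0 = relu x → s 1 = relu (-x) →
        |g x - lam n * (t 9 - t 10)| ≤ η) ∧
      ∀ j ∈ ({0, 1, 11, 12} : Finset (Fin 13)), t j = s j := by
  have hM' : (0 : ℝ) < M := by exact_mod_cast hM
  have hh : 0 < D / M := by positivity
  have hh4 : D / M ≤ 1 / 4 := by rw [div_le_iff₀ hM']; linarith
  have hMh : M * (D / M) = D := by field_simp
  have hmem : ∀ i < M, i * (D / M) ∈ Set.Ioo (-D) D := fun i hi => by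
    have h1 : (0 : ℝ) ≤ i * (D / M) := by positivity
    refine ⟨by linarith, ?_⟩
    calc i * (D / M) < M * (D / M) := by gcongr
      _ = D := hMh
  have h0 : (0 : ℝ) ∈ Set.Ioo (-D) D := ⟨by linarith, hD⟩
  have hc : |g 0 / lam n| ≤ 2 := by
    have h1 := hg.2 0 0 h0
    rw [iteratedDeriv_zero] at h1
    rw [abs_div, abs_of_pos hn, div_le_iff₀ hn]
    linarith [hlam n.zero_le]
  have hcoeff : ∀ {g : ℝ → ℝ}, DerivBounds lam D g → ∀ i < M,
      ∀ a ∈ taylorCoeffs g (lam n) n (i * (D / M)), |a| ≤ 2 := fun hg i hi a ha =>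
    (abs_taylorCoeffs_le hlam hg hn (hmem i hi) a ha).trans (by norm_num)
  obtain ⟨F, hF, hR⟩ := runs_twoSided k n hc hh.le (hh4.trans (by norm_num))
    (fun i => taylorCoeffs g (lam n) n (i * (D / M)))
    (fun i => taylorCoeffs (fun x => g (-x)) (lam n) n (i * (D / M)))
    (fun i => by simp [taylorCoeffs]) (fun i => by simp [taylorCoeffs]) M
    (hcoeff hg) (hcoeff hg.comp_neg)
  refine ⟨F, hF, fun s hs => ⟨fun x hx s0 s1 => ?_, (hR s hs).2⟩⟩
  rw [(hR s hs).1, s0, s1]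
  have hxabs := abs_lt.2 hx
  have h1 := hg.sum_hornerApprox hlam hD hn hM hM4 k (relu_nonneg x)
    (u := relu x) (max_lt hx.2 hD)
  have h2 := hg.comp_neg.sum_hornerApprox hlam hD hn hM hM4 k (relu_nonneg (-x))
    (u := relu (-x)) (max_lt (by linarith [hx.1]) hD)
  -- At most one of the two increments is nonzero, but both programs run, hence the factor 2 in
  -- `hη`.
  have h3 : g x = g 0 + (g (relu x) - g 0) + (g (-relu (-x)) - g (-0)) := by
    rcases le_total 0 x with h | h
    · rw [relu_of_nonneg h, show relu (-x) = 0 from max_eq_right (by linarith)]; ring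
    · rw [relu_of_nonneg (x := -x) (by linarith), show relu x = 0 from max_eq_right h]; simp
  refine le_trans ?_ hη
  rw [h3, mul_add, mul_add, mul_div_cancel₀ _ hn.ne']
  rw [abs_le] at *
  constructor <;> linarith [h1.1, h1.2, h2.1, h2.2]

/-! ### From programs to networks -/

namespace DNN

/-- The two extra layers load `relu x` and `relu (-x)` into registers 0 and 1 and read out the
result. Only the readout may use weights larger than 2. -/
lemma exists_network_of_runs {L : ℕ} {R : (Fin 13 → ℝ) → (Fin 13 → ℝ) → Prop} (h : Runs 13 L R)
    {p : ℕ} (hp : 0 < p) (W : Matrix (Fin p) (Fin 13) ℝ) {c : ℝ} (hc : 0 ≤ c)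
    (hW : ∀ i j, |W i j| ≤ c) :
    ∃ Φ : DNN 1 p, Φ.depth = L + 2 ∧ Φ.width ≤ max 13 p ∧ (Φ.weightBound : ℝ) ≤ max 2 c ∧
      ∀ x, ∃ s t, s 0 = relu x ∧ s 1 = relu (-x) ∧ R s t ∧
        Φ.eval relu (fun _ => x) = W.mulVec t := by
  lift c to ℝ≥0 using hc
  obtain ⟨F, hF, hR⟩ := h
  obtain ⟨Ψ, hd, hw, hb, he⟩ := hF.2 (last hp W 0)
  let V : Matrix (Fin 13) (Fin 1) ℝ := Matrix.of fun i _ => if i = 0 then 1 else if i = 1 then -1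
    else 0
  have hV : layerBound V (0 : Fin 13 → ℝ) ≤ 2 := layerBound_le
    (fun i j => by simp only [V, Matrix.of_apply]; split_ifs <;> norm_num) (fun i => by simp)
  have hlast : layerBound W (0 : Fin p → ℝ) ≤ c := layerBound_le hW (fun i => by simp)
  refine ⟨cons (by norm_num) V 0 Ψ, ?_, ?_, ?_, fun x => ?_⟩
  · simp only [depth] at hd ⊢; omega
  · simp only [width] at hw ⊢; omega
  · have : (cons (by norm_num) V 0 Ψ).weightBound ≤ max 2 c :=
      max_le (hV.trans (le_max_left _ _)) (hb.trans (max_le_max le_rfl hlast))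
    exact_mod_cast this
  · refine ⟨fun i => relu ((V.mulVec (fun _ => x) + 0) i), _, ?_, ?_, hR _ ?_, ?_⟩
    · simp [V, Matrix.mulVec, dotProduct]
    · simp [V, Matrix.mulVec, dotProduct]
    · exact fun i => relu_nonneg _
    · simp only [eval]
      rw [he _ fun i => relu_nonneg _]
      simp [eval]

lemma runs_move : Runs 13 2 fun s t => t 11 = s 9 ∧ t 12 = s 10 ∧ t 0 = s 0 ∧ t 1 = s 1 := by
  refine ⟨_, (Precomp.assign 11 9 0 1 (α := 1) (β := 0) (γ := 0) (b := 0)).comp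
    (Precomp.assign 12 10 0 1 (α := 1) (β := 0) (γ := 0) (b := 0)), fun s hs => ?_⟩
  simp [DNN.assign, relu_of_nonneg (hs 9), relu_of_nonneg (hs 10)]

/-- A network with a single layer. -/
lemma exists_affine_network {p : ℕ} (hp : 0 < p) (a b : Fin p → ℝ) {c : ℝ} (hc : 0 ≤ c)
    (ha : ∀ i, |a i| ≤ c) (hb : ∀ i, |b i| ≤ c) :
    ∃ Φ : DNN 1 p, Φ.depth = 1 ∧ Φ.width = p ∧ (Φ.weightBound : ℝ) ≤ c ∧
      ∀ x i, Φ.eval relu (fun _ => x) i = a i * x + b i := by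
  lift c to ℝ≥0 using hc
  refine ⟨last hp (Matrix.of fun i _ => a i) b, rfl, rfl, ?_, fun x i => ?_⟩
  · exact_mod_cast layerBound_le (W := Matrix.of fun i (_ : Fin 1) => a i) (fun i _ => ha i) hb
  · simp [eval, Matrix.mulVec, dotProduct]

end DNN

/-! ### Choice of the parameters -/

/-- If `lam n` or `D ^ 2 * lam n` is small, an affine function is a good approximation. -/
lemma DerivBounds.exists_affine {lam : ℕ → ℝ} (hlam : Monotone lam) (hpos : ∀ n, 0 < lam n)
    {D : ℝ} (hD : 0 < D) {g : ℝ → ℝ} (hg : DerivBounds lam D g) {n : ℕ} (hn : 2 ≤ n) {η : ℝ}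
    (h : lam n ≤ η ∨ D ^ 2 * lam n ≤ η) :
    ∃ a b, |a| ≤ lam n ∧ |b| ≤ lam n ∧ ∀ x ∈ Set.Ioo (-D) D, |g x - (a * x + b)| ≤ η := by
  have h0 : (0 : ℝ) ∈ Set.Ioo (-D) D := ⟨by linarith, hD⟩
  rcases h with h | h
  · refine ⟨0, 0, by simpa using (hpos n).le, by simpa using (hpos n).le, fun x hx => ?_⟩
    have := hg.2 0 x hx
    rw [iteratedDeriv_zero] at this
    simpa using this.trans ((hlam n.zero_le).trans h)
  · refine ⟨iteratedDeriv 1 g 0, iteratedDeriv 0 g 0, (hg.2 1 0 h0).trans (hlam (by omega)),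
      (hg.2 0 0 h0).trans (hlam (by omega)), fun x hx => ?_⟩
    have key : ∀ {g : ℝ → ℝ}, DerivBounds lam D g → ∀ y, 0 ≤ y → y < D →
        |g y - (iteratedDeriv 1 g 0 * y + iteratedDeriv 0 g 0)| ≤ η := by
      intro g hg y hy hyD
      have := hg.taylor 1 h0.1 hy (by linarith)
      simp only [Finset.sum_range_succ, Finset.sum_range_zero, zero_add, pow_zero, pow_one,
        Nat.factorial_zero, Nat.factorial_one, Nat.cast_one, div_one, mul_one] at this
      rw [add_comm (iteratedDeriv 1 g 0 * y)]
      refine this.trans (le_trans ?_ h)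
      rw [mul_comm]
      exact mul_le_mul (by gcongr) (hlam hn) (hpos _).le (by positivity)
    rcases le_total 0 x with hx0 | hx0
    · exact key hg x hx0 hx.2
    · have := key hg.comp_neg (-x) (by linarith) (by linarith [hx.1])
      rw [iteratedDeriv_comp_neg, iteratedDeriv_comp_neg] at this
      simpa using this

/-- The constant in the depth bound. -/
noncomputable def depthConst (lam : ℕ → ℝ) (D : ℝ) (n : ℕ) : ℝ :=
  16000 * max ((n : ℝ) + 2)
    (4 * (((n : ℝ) + 1) ^ (n - 1) * D ^ (n + 1) * lam (n + 1)) ^ (1 / ((n : ℝ) - 1)))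

lemma depthConst_pos (lam : ℕ → ℝ) (D : ℝ) (n : ℕ) : 0 < depthConst lam D n := by
  have : (0 : ℝ) < (n : ℝ) + 2 := by positivity
  exact mul_pos (by norm_num) (this.trans_le (le_max_left _ _))

/-- Lower bound on the depth at our disposal. -/
lemma le_depthBound {lam : ℕ → ℝ} (hpos : ∀ n, 0 < lam n) {D : ℝ} (hD : 0 < D) {n : ℕ}
    (hn : 2 ≤ n) {ε : ℝ} (h0 : 0 < ε) (h1 : ε < 1) (hε : ε ≤ D * lam n) {Q G : ℝ}
    (hQ : Q = max 1 ((D ^ (n + 1) * lam (n + 1) / ε) ^ (1 / ((n : ℝ) - 1))))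
    (hG : G = Real.log (2 * D * lam n / ε)) :
    16000 * (n + 1) * Q * (Q + G) ≤ depthBound (depthConst lam D n) n D (lam n) ε := by
  obtain ⟨m, rfl⟩ : ∃ m, n = m + 1 := ⟨n - 1, by omega⟩
  have hm : (1 : ℝ) ≤ m := by exact_mod_cast (by omega : 1 ≤ m)
  set B := depthConst lam D (m + 1) with hB
  have ha : ((m + 1 : ℕ) : ℝ) - 1 = m := by push_cast; ring
  rw [ha] at hQ
  have hlam := hpos (m + 1)
  have hlam' := hpos (m + 1 + 1)
  set E := ε ^ (-(1 / (m : ℝ))) with hE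
  have hE1 : 1 ≤ E := Real.one_le_rpow_of_pos_of_le_one_of_nonpos h0 h1.le
    (neg_nonpos.2 (by positivity))
  have hE2 : ε ^ (-(2 / (m : ℝ))) = E ^ 2 := by
    rw [hE, ← Real.rpow_mul_natCast h0.le]; congr 1; push_cast; ring
  have hG0 : 0 ≤ G := by
    rw [hG]; apply Real.log_nonneg; rw [le_div_iff₀ h0]; linarith
  have hQ1 : 1 ≤ Q := hQ ▸ le_max_left _ _
  have hK : 16000 * ((m + 1 : ℕ) + 1) * Q ≤ B * E := by
    rw [hQ, mul_max_of_nonneg _ _ (by positivity)]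
    apply max_le
    · calc 16000 * (((m + 1 : ℕ) : ℝ) + 1) * 1 ≤ 16000 * (((m + 1 : ℕ) : ℝ) + 2) * 1 := by
            gcongr; norm_num
        _ ≤ B * E := by
            refine mul_le_mul ?_ hE1 zero_le_one (depthConst_pos _ _ _).le
            exact mul_le_mul_of_nonneg_left (le_max_left _ _) (by norm_num)
    · have e1 : (D ^ (m + 1 + 1) * lam (m + 1 + 1) / ε) ^ (1 / (m : ℝ))
          = (D ^ (m + 1 + 1) * lam (m + 1 + 1)) ^ (1 / (m : ℝ)) * E := by
        rw [Real.div_rpow (by positivity) h0.le, hE, Real.rpow_neg h0.le, div_eq_mul_inv]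
      -- The factor `(n + 1) ^ (n - 1)` in the constant is chosen so that its root is `n + 1`, which
      -- pays for the number of Horner steps.
      have e2 : ((((m + 1 : ℕ) : ℝ) + 1) ^ (m + 1 - 1) * D ^ (m + 1 + 1) * lam (m + 1 + 1))
          ^ (1 / (((m + 1 : ℕ) : ℝ) - 1))
          = (((m + 1 : ℕ) : ℝ) + 1) * (D ^ (m + 1 + 1) * lam (m + 1 + 1)) ^ (1 / (m : ℝ)) := by
        rw [ha, mul_assoc, Real.mul_rpow (by positivity) (by positivity), Nat.add_sub_cancel,
          one_div, Real.pow_rpow_inv_natCast (by positivity) (by omega)]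
      rw [e1, ← mul_assoc]
      refine mul_le_mul_of_nonneg_right ?_ (by positivity)
      rw [hB, depthConst, e2, mul_assoc]
      refine mul_le_mul_of_nonneg_left ?_ (by norm_num)
      refine le_trans ?_ (le_max_right _ _)
      have : 0 ≤ (((m + 1 : ℕ) : ℝ) + 1) * (D ^ (m + 1 + 1) * lam (m + 1 + 1)) ^ (1 / (m : ℝ)) := by
        positivity
      linarith
  have hlog : Real.log (2 / ε) + Real.log D + Real.log (lam (m + 1)) = G := by
    rw [hG, ← Real.log_mul (by positivity) (by positivity),
      ← Real.log_mul (by positivity) (by positivity)]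
    congr 1; ring
  have hd : depthBound B (m + 1) D (lam (m + 1)) ε = B * E * (B * E + G) := by
    rw [depthBound, ha, hE2, ← hlog]; ring
  have hQK : Q ≤ B * E := by
    refine le_trans ?_ hK
    have : (0 : ℝ) ≤ (m + 1 : ℕ) := by positivity
    nlinarith
  rw [hd]
  exact mul_le_mul hK (by linarith) (by linarith) (by linarith)

/-- The number `M` of pieces and the precision `k` of the multiplications. -/
lemma exists_parameters {lam : ℕ → ℝ} (hlam : Monotone lam) (hpos : ∀ n, 0 < lam n)
    {D : ℝ} (hD : 0 < D) {n : ℕ} (hn : 2 ≤ n) {ε : ℝ} (h0 : 0 < ε) (h1 : ε < 1)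
    (hε : ε ≤ D * lam n) (hl : ε / 2 < lam n) (hDl : ε / 2 < D ^ 2 * lam n) :
    ∃ M k : ℕ, 0 < M ∧ 4 * D ≤ M ∧
      2 * (M * (lam n * (1 / 4) ^ k + lam (n + 1) * (D / M) ^ (n + 1) / n.factorial)) ≤ ε / 2 ∧
      ((2 * (4 + 2 * (M * (9 + n * (8 + 6 * k)))) + 4 : ℕ) : ℝ)
        ≤ depthBound (depthConst lam D n) n D (lam n) ε := by
  have hln := hpos n
  have hln' := hpos (n + 1)
  obtain ⟨P, hP⟩ : ∃ P, P = D ^ (n + 1) * lam (n + 1) / ε := ⟨_, rfl⟩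
  obtain ⟨Q, hQ⟩ : ∃ Q, Q = max 1 (P ^ (1 / ((n : ℝ) - 1))) := ⟨_, rfl⟩
  obtain ⟨G, hG⟩ : ∃ G, G = Real.log (2 * D * lam n / ε) := ⟨_, rfl⟩
  have hP0 : 0 < P := by rw [hP]; positivity
  have hQ1 : 1 ≤ Q := hQ ▸ le_max_left _ _
  have hG0 : 0 ≤ G := by
    rw [hG]; apply Real.log_nonneg; rw [le_div_iff₀ h0]; linarith
  have ha : 1 / ((n : ℝ) - 1) = ((n - 1 : ℕ) : ℝ)⁻¹ := by
    rw [Nat.cast_sub (by omega), Nat.cast_one, one_div]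
  have hPQ : P ≤ Q ^ (n - 1) := by
    have : P ^ (((n - 1 : ℕ) : ℝ)⁻¹) ≤ Q := by rw [hQ, ha]; exact le_max_right _ _
    calc P = (P ^ (((n - 1 : ℕ) : ℝ)⁻¹)) ^ (n - 1) :=
          (Real.rpow_inv_natCast_pow hP0.le (by omega)).symm
      _ ≤ Q ^ (n - 1) := by gcongr
  -- If `D > 2`, then `ε ≤ D * lam n` gives `D ^ (n - 1) ≤ P`, so a large `D` already forces a large
  -- `Q`; this ensures `4 * D ≤ M`.
  have hDQ : D ≤ 2 * Q := by
    by_contra! hcon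
    have hD2 : 2 < D := by linarith
    have hDP : D ^ (n - 1) ≤ P := by
      rw [hP, le_div_iff₀ h0, show n + 1 = n - 1 + 2 by omega, pow_add, mul_assoc]
      have h3 : lam n ≤ lam (n - 1 + 2) := hlam (by omega)
      gcongr
      nlinarith
    have hDQ : Q ^ (n - 1) < D ^ (n - 1) :=
      pow_lt_pow_left₀ (by linarith) (by linarith) (by omega)
    linarith
  set M := ⌈8 * Q⌉₊ with hM
  have hM8 : 8 * Q ≤ M := Nat.le_ceil _
  have hM9 : (M : ℝ) ≤ 9 * Q := by
    have := Nat.ceil_lt_add_one (show 0 ≤ 8 * Q by linarith)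
    linarith
  have hM0 : (0 : ℝ) < M := by linarith
  -- Makes the total multiplication error `M * lam n * 4 ^ (-k)` at most `ε / 8`; the natural
  -- logarithm suffices because `1 / 4 ≤ exp (-1)`.
  set k := ⌈Real.log (8 * M * lam n / ε)⌉₊ with hk
  have harg : 1 ≤ 8 * M * lam n / ε := by
    rw [le_div_iff₀ h0]; nlinarith
  have hk1 : (1 / 4 : ℝ) ^ k ≤ ε / (8 * M * lam n) := by
    have h4 : (1 / 4 : ℝ) ≤ Real.exp (-1) := by
      rw [Real.exp_neg, one_div]
      exact inv_anti₀ (Real.exp_pos 1) (by linarith [Real.exp_one_lt_d9])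
    calc (1 / 4 : ℝ) ^ k ≤ Real.exp (-1) ^ k := by gcongr
      _ = Real.exp (-k) := by rw [← Real.exp_nat_mul]; ring_nf
      _ ≤ Real.exp (-Real.log (8 * M * lam n / ε)) := by
          gcongr; exact Nat.le_ceil _
      _ = ε / (8 * M * lam n) := by
          rw [Real.exp_neg, Real.exp_log (by linarith), inv_div]
  have hk2 : (k : ℝ) ≤ 72 * Q + 2 * G := by
    have h2 := Nat.ceil_lt_add_one (Real.log_nonneg harg)
    have h3 : Real.log (8 * M * lam n / ε) = Real.log (8 * M) + Real.log (lam n / ε) := by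
      rw [← Real.log_mul (by positivity) (by positivity)]; congr 1; ring
    -- This crude bound is affordable: it contributes a multiple of `Q ^ 2` to the depth, matching
    -- the quadratic term allowed.
    have h4 : Real.log (8 * M) ≤ 8 * M - 1 := Real.log_le_sub_one_of_pos (by positivity)
    -- After squaring, this is `ε ≤ 4 * D ^ 2 * lam n`, which holds outside the affine case.
    have h5 : Real.log (lam n / ε) ≤ 2 * G := by
      rw [hG, show (2 : ℝ) * Real.log (2 * D * lam n / ε)
        = Real.log ((2 * D * lam n / ε) ^ 2) by rw [Real.log_pow]; norm_num]
      apply Real.log_le_log (by positivity)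
      rw [div_pow, div_le_div_iff₀ h0 (by positivity)]
      nlinarith [mul_pos hln h0, mul_pos (mul_pos hln h0) h0]
    linarith
  refine ⟨M, k, by exact_mod_cast hM0, by linarith, ?_, ?_⟩
  · have e1 : M * (lam n * (1 / 4) ^ k) ≤ ε / 8 := by
      calc M * (lam n * (1 / 4) ^ k) ≤ M * (lam n * (ε / (8 * M * lam n))) := by gcongr
        _ = ε / 8 := by field_simp
    -- The total Taylor error is at most `ε * P / M ^ n`, so the exponent `n - 1` in the choice of
    -- `Q` leaves a power to spare.
    have hMn : 64 * P ≤ (M : ℝ) ^ n := by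
      calc 64 * P ≤ 8 ^ n * Q ^ n := by
            have h8 : (64 : ℝ) ≤ 8 ^ n := by
              calc (64 : ℝ) = 8 ^ 2 := by norm_num
                _ ≤ 8 ^ n := pow_le_pow_right₀ (by norm_num) hn
            have hq : P ≤ Q ^ n := hPQ.trans (pow_le_pow_right₀ hQ1 (by omega))
            gcongr
        _ = (8 * Q) ^ n := (mul_pow _ _ _).symm
        _ ≤ (M : ℝ) ^ n := by gcongr
    have hf : (1 : ℝ) ≤ n.factorial := by exact_mod_cast Nat.factorial_pos _
    have e2 : M * (lam (n + 1) * (D / M) ^ (n + 1) / n.factorial) ≤ ε / 64 := by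
      calc M * (lam (n + 1) * (D / M) ^ (n + 1) / n.factorial)
          ≤ M * (lam (n + 1) * (D / M) ^ (n + 1) / 1) := by gcongr
        _ = ε * P / M ^ n := by rw [hP, div_pow, pow_succ (M : ℝ) n]; field_simp
        _ ≤ ε / 64 := by
            rw [div_le_div_iff₀ (by positivity) (by norm_num)]
            nlinarith
    linarith
  · have hQ' : Q = max 1 ((D ^ (n + 1) * lam (n + 1) / ε) ^ (1 / ((n : ℝ) - 1))) := by
      rw [← hP]; exact hQ
    refine le_trans ?_ (le_depthBound hpos hD hn h0 h1 hε hQ' hG)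
    have hn' : (2 : ℝ) ≤ n := by exact_mod_cast hn
    push_cast
    have t1 : (9 + n * (8 + 6 * k) : ℝ) ≤ (n + 1) * (443 * Q + 12 * G) := by
      have : (n : ℝ) * (8 + 6 * k) ≤ (n + 1) * (8 * Q + 6 * (72 * Q + 2 * G)) :=
        mul_le_mul (by linarith) (by linarith) (by positivity) (by positivity)
      have : 9 ≤ (n + 1) * (3 * Q) := by nlinarith
      linarith
    have t2 : (M * (9 + n * (8 + 6 * k)) : ℝ) ≤ 9 * Q * ((n + 1) * (443 * Q + 12 * G)) := by
      gcongr
    have t3 : 0 ≤ Q * (n + 1) * G := by positivity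
    have t4 : 3 ≤ Q * (n + 1) * Q := by
      calc (3 : ℝ) ≤ 1 * (n + 1) * 1 := by linarith
        _ ≤ Q * (n + 1) * Q := by gcongr
    -- The constant 16000 comes from here: `4 * 3987 = 15948`, plus 4 for the constant number 12 of
    -- layers.
    rw [show 9 * Q * ((n + 1) * (443 * Q + 12 * G))
      = 3987 * (Q * (n + 1) * Q) + 108 * (Q * (n + 1) * G) by ring] at t2
    rw [show 16000 * (n + 1) * Q * (Q + G)
      = 16000 * (Q * (n + 1) * Q) + 16000 * (Q * (n + 1) * G) by ring]
    linarith

lemma one_le_depthBound {lam : ℕ → ℝ} (hpos : ∀ n, 0 < lam n) {D : ℝ} (hD : 0 < D) {n : ℕ}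
    (hn : 2 ≤ n) {ε : ℝ} (h0 : 0 < ε) (h1 : ε < 1) (hε : ε ≤ D * lam n) :
    1 ≤ depthBound (depthConst lam D n) n D (lam n) ε := by
  refine le_trans ?_ (le_depthBound hpos hD hn h0 h1 hε rfl rfl)
  have hG : 0 ≤ Real.log (2 * D * lam n / ε) := by
    apply Real.log_nonneg; rw [le_div_iff₀ h0]; linarith
  have hQ : 1 ≤ max 1 ((D ^ (n + 1) * lam (n + 1) / ε) ^ (1 / ((n : ℝ) - 1))) := le_max_left _ _
  have hn0 : (0 : ℝ) ≤ n := by positivity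
  refine one_le_mul_of_one_le_of_one_le (one_le_mul_of_one_le_of_one_le (by linarith) hQ) ?_
  linarith

/-! ### The approximation theorem -/

lemma exists_network_real {lam : ℕ → ℝ} (hlam : Monotone lam) (hpos : ∀ n, 0 < lam n)
    {D : ℝ} (hD : 0 < D) {n : ℕ} (hn : 2 ≤ n) {ε : ℝ} (h0 : 0 < ε) (h1 : ε < 1)
    (hε : ε ≤ D * lam n) {g : ℝ → ℝ} (hg : DerivBounds lam D g) :
    ∃ Φ : DNN 1 1, (Φ.depth : ℝ) ≤ depthBound (depthConst lam D n) n D (lam n) ε ∧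
      Φ.width ≤ 13 ∧ (Φ.weightBound : ℝ) ≤ max 2 (lam n) ∧
      ∀ x ∈ Set.Ioo (-D) D, |g x - Φ.eval relu (fun _ => x) 0| ≤ ε / 2 := by
  have hln := hpos n
  by_cases hc : lam n ≤ ε / 2 ∨ D ^ 2 * lam n ≤ ε / 2
  · obtain ⟨a, b, ha, hb, hab⟩ := hg.exists_affine hlam hpos hD hn hc
    obtain ⟨Φ, hd, hw, hB, he⟩ := DNN.exists_affine_network one_pos (fun _ => a) (fun _ => b)
      hln.le (fun _ => ha) (fun _ => hb)
    refine ⟨Φ, ?_, by omega, hB.trans (le_max_right _ _), fun x hx => ?_⟩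
    · rw [hd, Nat.cast_one]; exact one_le_depthBound hpos hD hn h0 h1 hε
    · rw [he]; exact hab x hx
  · push Not at hc
    obtain ⟨M, k, hM, hM4, hη, hdepth⟩ :=
      exists_parameters hlam hpos hD hn h0 h1 hε hc.1 hc.2
    obtain ⟨Φ, hd, hw, hB, he⟩ := DNN.exists_network_of_runs
      (hg.runs hlam hD hln hM hM4 k hη) one_pos
      (Matrix.of fun _ j => if j = 9 then lam n else if j = 10 then -lam n else 0) hln.le
      (fun i j => by
        rw [Matrix.of_apply]; split_ifs <;> simp [abs_of_pos hln, hln.le])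
    refine ⟨Φ, le_trans ?_ hdepth, by omega, hB, fun x hx => ?_⟩
    · rw [hd]; exact_mod_cast by omega
    · obtain ⟨s, t, s0, s1, hR, hΦ⟩ := he x
      convert hR.1 x hx s0 s1 using 2
      rw [hΦ]
      simp [Matrix.mulVec, dotProduct, Fin.sum_univ_succ]
      ring

/-- The two programs run one after the other on the same input registers; the first result is parked
in registers 11 and 12, so the width does not grow. -/
lemma exists_network_pair {lam : ℕ → ℝ} (hlam : Monotone lam) (hpos : ∀ n, 0 < lam n)
    {D : ℝ} (hD : 0 < D) {n : ℕ} (hn : 2 ≤ n) {ε : ℝ} (h0 : 0 < ε) (h1 : ε < 1)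
    (hε : ε ≤ D * lam n) {g g' : ℝ → ℝ} (hg : DerivBounds lam D g) (hg' : DerivBounds lam D g') :
    ∃ Φ : DNN 1 2, (Φ.depth : ℝ) ≤ depthBound (depthConst lam D n) n D (lam n) ε ∧
      Φ.width ≤ 15 ∧ (Φ.weightBound : ℝ) ≤ max 2 (lam n) ∧
      ∀ x ∈ Set.Ioo (-D) D, |g x - Φ.eval relu (fun _ => x) 0| ≤ ε / 2 ∧
        |g' x - Φ.eval relu (fun _ => x) 1| ≤ ε / 2 := by
  have hln := hpos n
  by_cases hc : lam n ≤ ε / 2 ∨ D ^ 2 * lam n ≤ ε / 2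
  · obtain ⟨a, b, ha, hb, hab⟩ := hg.exists_affine hlam hpos hD hn hc
    obtain ⟨a', b', ha', hb', hab'⟩ := hg'.exists_affine hlam hpos hD hn hc
    obtain ⟨Φ, hd, hw, hB, he⟩ := DNN.exists_affine_network two_pos ![a, a'] ![b, b']
      hln.le (Fin.forall_fin_two.2 ⟨ha, ha'⟩) (Fin.forall_fin_two.2 ⟨hb, hb'⟩)
    refine ⟨Φ, ?_, by omega, hB.trans (le_max_right _ _), fun x hx => ?_⟩
    · rw [hd, Nat.cast_one]; exact one_le_depthBound hpos hD hn h0 h1 hε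
    · rw [he, he]; exact ⟨hab x hx, hab' x hx⟩
  · push Not at hc
    obtain ⟨M, k, hM, hM4, hη, hdepth⟩ :=
      exists_parameters hlam hpos hD hn h0 h1 hε hc.1 hc.2
    have hruns := ((hg.runs hlam hD hln hM hM4 k hη).comp DNN.runs_move
      (R'' := fun s t => (∀ x ∈ Set.Ioo (-D) D, s 0 = relu x → s 1 = relu (-x) →
        |g x - lam n * (t 11 - t 12)| ≤ ε / 2) ∧ t 0 = s 0 ∧ t 1 = s 1) (by
        rintro s t r - - - ⟨ht, tj⟩ ⟨r11, r12, r0, r1⟩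
        rw [r11, r12, r0, r1]
        exact ⟨ht, tj 0 (by decide), tj 1 (by decide)⟩)).comp
      (hg'.runs hlam hD hln hM hM4 k hη)
      (R'' := fun s t => ∀ x ∈ Set.Ioo (-D) D, s 0 = relu x → s 1 = relu (-x) →
        |g x - lam n * (t 11 - t 12)| ≤ ε / 2 ∧ |g' x - lam n * (t 9 - t 10)| ≤ ε / 2) (by
        rintro s t r - - - ⟨ht, t0, t1⟩ ⟨hr, rj⟩ x hx s0 s1
        rw [rj 11 (by decide), rj 12 (by decide)]
        exact ⟨ht x hx s0 s1, hr x hx (t0.trans s0) (t1.trans s1)⟩)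
    obtain ⟨Φ, hd, hw, hB, he⟩ := DNN.exists_network_of_runs hruns two_pos
      (Matrix.of ![fun j => if j = 11 then lam n else if j = 12 then -lam n else 0,
        fun j => if j = 9 then lam n else if j = 10 then -lam n else 0]) hln.le
      (Fin.forall_fin_two.2 ⟨fun j => by
          simp only [Matrix.of_apply, Matrix.cons_val_zero]
          split_ifs <;> simp [abs_of_pos hln, hln.le],
        fun j => by
          simp only [Matrix.of_apply, Matrix.cons_val_one, Matrix.cons_val_zero]
          split_ifs <;> simp [abs_of_pos hln, hln.le]⟩)
    refine ⟨Φ, le_trans ?_ hdepth, by omega, hB, fun x hx => ?_⟩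
    · rw [hd]; exact_mod_cast by omega
    · obtain ⟨s, t, s0, s1, hR, hΦ⟩ := he x
      have hR := hR x hx s0 s1
      constructor
      · convert hR.1 using 2
        rw [hΦ]
        simp [Matrix.mulVec, dotProduct, Fin.sum_univ_succ]
        ring
      · convert hR.2 using 2
        rw [hΦ]
        simp [Matrix.mulVec, dotProduct, Fin.sum_univ_succ]
        ring

theorem propositionA2 :
    ∃ (C : ℝ) (Ct : ℕ → ℝ), 0 < C ∧ (∀ n, 0 < Ct n) ∧
      ∀ (lam : ℕ → ℝ), Monotone lam → (∀ n, 0 < lam n) →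
      ∀ (D : ℝ), 0 < D →
      ∀ (n : ℕ), 2 ≤ n →
      ∃ B : ℝ, 0 < B ∧
        B ≤ C * max ((n : ℝ) + 2)
          (4 * (Ct n * D ^ (n + 1) * lam (n + 1)) ^ (1 / ((n : ℝ) - 1))) ∧
        -- real-valued functions
        (∀ f ∈ smoothClass lam D ℝ, ∀ ε : ℝ, 0 < ε → ε < 1 → ε ≤ D * lam n →
          ∃ Φ : DNN 1 1,
            (Φ.depth : ℝ) ≤ depthBound B n D (lam n) ε ∧
            Φ.width ≤ 13 ∧
            (Φ.weightBound : ℝ) ≤ max 2 (lam n) ∧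
            ∀ x ∈ Set.Ioo (-D) D, |f x - Φ.eval relu (fun _ => x) 0| ≤ ε) ∧
        -- complex-valued functions
        (∀ f ∈ smoothClass lam D ℂ, ∀ ε : ℝ, 0 < ε → ε < 1 → ε ≤ D * lam n →
          ∃ Φ : DNN 1 2,
            (Φ.depth : ℝ) ≤ depthBound B n D (lam n) ε ∧
            Φ.width ≤ 15 ∧
            (Φ.weightBound : ℝ) ≤ max 2 (lam n) ∧
            ∀ x ∈ Set.Ioo (-D) D,
              ‖f x - ((Φ.eval relu (fun _ => x) 0 : ℂ)
                + Complex.I * (Φ.eval relu (fun _ => x) 1 : ℂ))‖ ≤ ε) := by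

  refine ⟨16000, fun n => ((n : ℝ) + 1) ^ (n - 1), by norm_num, fun n => by positivity, ?_⟩
  intro lam hlam hpos D hD n hn
  refine ⟨depthConst lam D n, depthConst_pos _ _ _, le_rfl, fun f hf ε h0 h1 hε => ?_,
    fun f hf ε h0 h1 hε => ?_⟩
  · obtain ⟨Φ, hd, hw, hB, he⟩ := exists_network_real hlam hpos hD hn h0 h1 hε
      (DerivBounds.clm_comp hf (ContinuousLinearMap.id ℝ ℝ) fun _ => le_rfl)
    exact ⟨Φ, hd, hw, hB, fun x hx => (he x hx).trans (by linarith)⟩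
  · obtain ⟨Φ, hd, hw, hB, he⟩ := exists_network_pair hlam hpos hD hn h0 h1 hε
      (DerivBounds.clm_comp hf Complex.reCLM Complex.abs_re_le_norm)
      (DerivBounds.clm_comp hf Complex.imCLM Complex.abs_im_le_norm)
    -- Real and imaginary parts each have error `ε / 2`, which add up to `ε`.
    refine ⟨Φ, hd, hw, hB, fun x hx => (Complex.norm_le_abs_re_add_abs_im _).trans ?_⟩
    have := he x hx
    simp only [Complex.reCLM_apply, Complex.imCLM_apply] at this
    simp only [Complex.sub_re, Complex.add_re, Complex.sub_im, Complex.add_im, Complex.ofReal_re,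
      Complex.ofReal_im, Complex.I_mul_re, Complex.I_mul_im, neg_zero, add_zero, zero_add]
    linarith [this.1, this.2]
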